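/- For an integer $k\ge 1$ let $A_k=\{0,\dots,k-1\}$, let $T_k$ be the rooted tree whose vertices are the words over $A_k$ (the children of $w$ being the words $wa$, $a\in A_k$), and let $\widehat G=\wr^{\infty}(\mathbb Z/k\mathbb Z,A_k)\le \mathrm{Aut}(T_k)$ be the iterated permutational wreath product of $\mathbb Z/k\mathbb Z$ acting on $A_k$ by translations modulo $k$; that is, $\widehat G$ consists of all automorphisms $f$ of $T_k$ such that for every word $w$ there is an $s\in\mathbb Z/k\mathbb Z$ with $f(wa)=f(w)\,(a+s \bmod k)$ for all $a\in A_k$. An element $f\in\widehat G$ is *spherically transitive* if, for every $n\ge 0$, the cyclic group $\langle f\rangle$ acts transitively on the words of length $n$. An *initial automaton* over $A_k$ consists of a finite set $Q$ of states, a transition function $Q\times A_k\to Q$, $(q,a)\mapsto q_a$, an output function $Q\times A_k\to A_k$, $(q,a)\mapsto q(a)$, and an initial state; it computes the function on words defined by its initial state through $q(\varepsilon)=\varepsilon$ and $q(au)=q(a)\,q_a(u)$. **Theorem.** Conjugacy in $\widehat G$ of finite state spherically transitive elements, given by finite initial automata, is decidable, and so is spherical transitivity itself, uniformly in $k$: 1.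 There is an algorithm which, given $k\ge 1$ and an initial automaton over $A_k$ computing an element $f\in\widehat G$, decides whether $f$ is spherically transitive. 2. There is an algorithm which, given $k\ge 1$ and two initial automata over $A_k$ computing elements $f,g\in\widehat G$ at least one of which is spherically transitive, decides whether $f$ and $g$ are conjugate in $\widehat G$. -/

import Mathlib

/-- The automorphism group of the rooted regular `k`-ary tree. The vertices are the words over the
alphabet `{0, …, k - 1}`, the root is the empty word, and `u` is an ancestor of `v` when `u` is a
prefix of `v`; an automorphism is a bijection of the vertices preserving this relation both ways. -/
def treeAut (k : ℕ) : Subgroup (Equiv.Perm (List (Fin k))) where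
  carrier := {f | ∀ u v : List (Fin k), f u <+: f v ↔ u <+: v}
  one_mem' := fun _ _ => Iff.rfl
  mul_mem' := fun {f g} hf hg u v => (hf (g u) (g v)).trans (hg u v)
  inv_mem' := fun {f} hf u v => by
    simpa using (hf (f⁻¹ u) (f⁻¹ v)).symm

/-- The infinite iterated permutational wreath product `(G, A) ≀ (G, A) ≀ ⋯` of a permutation group
`G` on `A = {0, …, k - 1}`: the group of all tree automorphisms `f` such that at each vertex `w` the
permutation of `A` by which the section of `f` at `w` acts on the first level belongs to `G`. -/
def iteratedWreath {k : ℕ} (G : Subgroup (Equiv.Perm (Fin k))) :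
    Subgroup (Equiv.Perm (List (Fin k))) where
  carrier := {f | f ∈ treeAut k ∧
    ∀ w : List (Fin k), ∃ σ ∈ G, ∀ a : Fin k, f (w ++ [a]) = f w ++ [σ a]}
  one_mem' := ⟨one_mem _, fun _ => ⟨1, one_mem _, fun _ => rfl⟩⟩
  mul_mem' := fun {f g} hf hg => ⟨mul_mem hf.1 hg.1, fun w => by
    obtain ⟨σ, hσ, h⟩ := hg.2 w
    obtain ⟨τ, hτ, h'⟩ := hf.2 (g w)
    exact ⟨τ * σ, mul_mem hτ hσ, fun a => by simp [h, h']⟩⟩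
  inv_mem' := fun {f} hf => ⟨inv_mem hf.1, fun w => by
    obtain ⟨σ, hσ, h⟩ := hf.2 (f⁻¹ w)
    refine ⟨σ⁻¹, inv_mem hσ, fun a => f.injective ?_⟩
    rw [h (σ⁻¹ a)]
    simp⟩

/-- The iterated wreath product of `ℤ/kℤ`, acting on `{0, …, k - 1}` by translations modulo `k`
(the group generated by the cycle `a ↦ a + 1`). -/
abbrev cyclicWreath (k : ℕ) : Subgroup (Equiv.Perm (List (Fin k))) :=
  iteratedWreath (Subgroup.zpowers (finRotate k))

/-- `f` is spherically transitive: for each `n` the cyclic group generated by `f` acts transitively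
on the words of length `n`. -/
def SphericallyTransitive {k : ℕ} (f : Equiv.Perm (List (Fin k))) : Prop :=
  ∀ (n : ℕ) (u v : List (Fin k)), u.length = n → v.length = n → ∃ i : ℤ, (f ^ i) u = v

/-- A finite state automaton with states `{0, …, n - 1}` and alphabet `{0, …, k - 1}`, together with
a distinguished initial state. -/
structure InitialAutomaton (n k : ℕ) where
  /-- The transition function. -/
  next : Fin n → Fin k → Fin n
  /-- The output function. -/
  out : Fin n → Fin k → Fin k
  /-- The initial state. -/
  init : Fin n

namespace InitialAutomaton

/-- The function on words given by a state `q`: `q(au) = q(a) q_a(u)`. -/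
def run {n k : ℕ} (A : InitialAutomaton n k) : Fin n → List (Fin k) → List (Fin k)
  | _, [] => []
  | q, a :: u => A.out q a :: A.run (A.next q a) u

/-- The automaton computes `f`: its initial state gives the function `f` on words. -/
def Computes {n k : ℕ} (A : InitialAutomaton n k) (f : Equiv.Perm (List (Fin k))) : Prop :=
  ∀ w : List (Fin k), A.run A.init w = f w

/-- The explicit finite description of an automaton that is handed to an algorithm: the initial
state, and for each state the table listing, for each letter, the next state and the output. -/
def code {n k : ℕ} (A : InitialAutomaton n k) : ℕ × List (List (ℕ × ℕ)) :=
  ((A.init : ℕ),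
    List.ofFn fun q => List.ofFn fun a => ((A.next q a : ℕ), (A.out q a : ℕ)))

end InitialAutomaton

/-!
The labels of an element `f` of the iterated wreath product are the residues `s` with
`f (w a) = f w (a + s)`, one for each vertex `w`. The sum `levelSum f n` of the labels over level
`n` is a homomorphism to `ℤ/kℤ`, hence a conjugacy invariant.

If `f` acts transitively on level `n`, which has `k ^ n` vertices, then `f ^ (k ^ n)` fixes
`0 ⋯ 0` and translates its children by `levelSum f n`, because by the cocycle identity it collects
the labels along the orbit. So `f` is transitive on the next level exactly when `levelSum f n` is a
unit (`sphericallyTransitive_iff`). Moreover, when all these sums are units, the exponents `i` for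
which `f ^ i (0 ⋯ 0) = 0 ⋯ 0` at level `n` are the multiples of `k ^ n`; for a second element `g`
with the same level sums, `f ^ i (0 ⋯ 0) ↦ g ^ i (0 ⋯ 0)` is then a bijection, and it is an element
of the wreath product conjugating `f` to `g` since both return maps translate by the same amount
(`isConj_of_levelSum_eq`). Thus the level sums are a complete conjugacy invariant among spherically
transitive elements.

For an automaton with `n` states, grouping words by their first letter shows that the level sums are
obtained by iterating a linear operator on `ℤ/kℤ`-valued functions of the states
(`InitialAutomaton.levelSum_eq_transfer_iterate`). Such functions being `k ^ n` in number, the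
sequence of level sums takes all its values at the indices below `k ^ n`, and the sequence of
pairs of level sums of two automata with `m` and `n` states takes all its values at the indices
below `k ^ (m + n)`. The resulting finite tests are primitive recursive in the codes of the automata.
-/

/-! ### Labels and vertices of the tree -/

section WreathProduct

variable {k : ℕ}

theorem fin_eq_of_cast_zmod_eq {a b : Fin k} (h : (a.val : ZMod k) = (b.val : ZMod k)) :
    a = b := by
  rw [ZMod.natCast_eq_natCast_iff', Nat.mod_eq_of_lt a.2, Nat.mod_eq_of_lt b.2] at h
  exact Fin.ext h

theorem cast_finRotate (a : Fin k) : ((finRotate k a).val : ZMod k) = a.val + 1 := by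
  rw [finRotate_apply, Fin.val_add]
  simp

theorem apply_nil {f : Equiv.Perm (List (Fin k))} (hf : f ∈ cyclicWreath k) : f [] = [] := by
  have h := (hf.1 [] (f⁻¹ [])).mpr List.nil_prefix
  simpa using h

theorem zpow_mem_cyclicWreath {f : Equiv.Perm (List (Fin k))} (hf : f ∈ cyclicWreath k) (i : ℤ) :
    f ^ i ∈ cyclicWreath k := Subgroup.zpow_mem _ hf i

variable (k) in
/-- The finite set of vertices of level `n`. -/
noncomputable def treeLevel (n : ℕ) : Finset (List (Fin k)) :=
  (List.finite_length_eq (Fin k) n).toFinset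

@[simp] theorem mem_treeLevel {n : ℕ} {w : List (Fin k)} : w ∈ treeLevel k n ↔ w.length = n := by
  simp [treeLevel]

theorem sum_treeLevel_zero {M : Type*} [AddCommMonoid M] (F : List (Fin k) → M) :
    ∑ w ∈ treeLevel k 0, F w = F [] := by
  have : treeLevel k 0 = {[]} := by ext w; simp
  simp [this]

theorem sum_treeLevel_succ {M : Type*} [AddCommMonoid M] (n : ℕ) (F : List (Fin k) → M) :
    ∑ w ∈ treeLevel k (n + 1), F w = ∑ a : Fin k, ∑ w ∈ treeLevel k n, F (a :: w) := by
  rw [← Finset.sum_product']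
  symm
  refine Finset.sum_bij (fun p _ => p.1 :: p.2) ?_ ?_ ?_ ?_
  · intro p hp
    simpa using hp
  · rintro ⟨a, u⟩ _ ⟨b, v⟩ _ h
    simpa using h
  · rintro (_ | ⟨a, u⟩) hu
    · simp at hu
    · exact ⟨(a, u), by simpa using hu, rfl⟩
  · intros
    rfl

theorem cast_finRotate_pow (i : ℕ) (a : Fin k) :
    (((finRotate k ^ i) a).val : ZMod k) = a.val + i := by
  induction i with
  | zero => simp
  | succ i ih =>
    rw [pow_succ', Equiv.Perm.mul_apply, cast_finRotate, ih]
    push_cast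
    ring

theorem card_treeLevel (n : ℕ) : (treeLevel k n).card = k ^ n := by
  induction n with
  | zero => rw [Finset.card_eq_sum_ones, sum_treeLevel_zero, pow_zero]
  | succ n ih =>
    rw [Finset.card_eq_sum_ones, sum_treeLevel_succ]
    simp [ih, pow_succ']

variable [NeZero k]

theorem exists_fin_cast_eq (s : ZMod k) : ∃ a : Fin k, (a.val : ZMod k) = s :=
  ⟨⟨s.val, ZMod.val_lt s⟩, ZMod.natCast_zmod_val s⟩

/-- The powers of the cycle `a ↦ a + 1` are exactly the translations modulo `k`. -/
theorem mem_zpowers_finRotate_iff {σ : Equiv.Perm (Fin k)} :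
    σ ∈ Subgroup.zpowers (finRotate k) ↔
      ∃ s : ZMod k, ∀ a : Fin k, ((σ a).val : ZMod k) = a.val + s := by
  constructor
  · intro h
    obtain ⟨i, rfl⟩ := mem_zpowers_iff_mem_range_orderOf.mp h |> Finset.mem_image.mp |>.imp
      fun i hi => hi.2
    exact ⟨i, cast_finRotate_pow i⟩
  · rintro ⟨s, hs⟩
    have : σ = finRotate k ^ s.val := by
      ext1 a
      apply fin_eq_of_cast_zmod_eq
      rw [hs, cast_finRotate_pow, ZMod.natCast_zmod_val]
    rw [this]
    exact Subgroup.npow_mem_zpowers _ _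

/-- The label of `f` at the vertex `w`: the residue `s` such that `f (w a) = f w (a + s)` for every
letter `a`, read off from the image of the child `w 0`. It is meaningful for `f` in the iterated
wreath product of `ℤ/kℤ` only. -/
def label (f : Equiv.Perm (List (Fin k))) (w : List (Fin k)) : ZMod k :=
  (((f (w ++ [0])).getLastD 0).val : ZMod k)

theorem apply_append_singleton {f : Equiv.Perm (List (Fin k))} (hf : f ∈ cyclicWreath k)
    (w : List (Fin k)) (a : Fin k) :
    ∃ b : Fin k, f (w ++ [a]) = f w ++ [b] ∧ (b.val : ZMod k) = a.val + label f w := by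
  obtain ⟨σ, hσ, h⟩ := hf.2 w
  obtain ⟨s, hs⟩ := mem_zpowers_finRotate_iff.mp hσ
  refine ⟨σ a, h a, ?_⟩
  rw [hs, label, h 0]
  simp [hs]

theorem label_eq_of_apply {f : Equiv.Perm (List (Fin k))} (hf : f ∈ cyclicWreath k)
    {w u : List (Fin k)} {a b : Fin k} (h : f (w ++ [a]) = u ++ [b]) :
    label f w = b.val - a.val := by
  obtain ⟨c, hc, hs⟩ := apply_append_singleton hf w a
  rw [hc] at h
  have : c = b := by simpa using (List.append_inj' h rfl).2
  rw [← this, hs]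
  ring

theorem length_apply {f : Equiv.Perm (List (Fin k))} (hf : f ∈ cyclicWreath k)
    (w : List (Fin k)) : (f w).length = w.length := by
  induction w using List.reverseRecOn with
  | nil => simp [apply_nil hf]
  | append_singleton w a ih =>
    obtain ⟨b, hb, -⟩ := apply_append_singleton hf w a
    simp [hb, ih]

theorem take_apply {f : Equiv.Perm (List (Fin k))} (hf : f ∈ cyclicWreath k)
    (w : List (Fin k)) (n : ℕ) : (f w).take n = f (w.take n) := by
  have h := (hf.1 _ _).mpr (List.take_prefix n w)
  rw [List.prefix_iff_eq_take.mp h, length_apply hf, List.length_take]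
  rcases le_total n w.length with hn | hn
  · rw [min_eq_left hn]
  · rw [min_eq_right hn, List.take_of_length_le (by rw [length_apply hf]; exact hn),
      List.take_of_length_le (by rw [length_apply hf])]

theorem label_one (w : List (Fin k)) : label (1 : Equiv.Perm (List (Fin k))) w = 0 := by
  simp [label]

theorem label_mul {f g : Equiv.Perm (List (Fin k))} (hf : f ∈ cyclicWreath k)
    (hg : g ∈ cyclicWreath k) (w : List (Fin k)) :
    label (f * g) w = label f (g w) + label g w := by
  obtain ⟨b, hb, hb'⟩ := apply_append_singleton hg w 0
  obtain ⟨c, hc, hc'⟩ := apply_append_singleton hf (g w) b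
  rw [label_eq_of_apply (mul_mem hf hg) (a := 0) (b := c) (u := f (g w)) (by simp [hb, hc]), hc',
    hb']
  ring

/-- The cocycle identity along an orbit. -/
theorem label_pow {f : Equiv.Perm (List (Fin k))} (hf : f ∈ cyclicWreath k) (w : List (Fin k))
    (i : ℕ) : label (f ^ i) w = ∑ j ∈ Finset.range i, label f ((f ^ j) w) := by
  induction i with
  | zero => simp [label_one]
  | succ i ih =>
    rw [pow_succ', label_mul hf (Subgroup.pow_mem _ hf i), Finset.sum_range_succ, ih, add_comm]

theorem label_zpow_of_fixed {f : Equiv.Perm (List (Fin k))} (hf : f ∈ cyclicWreath k)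
    {w : List (Fin k)} (hw : f w = w) (i : ℤ) : label (f ^ i) w = i * label f w := by
  have key : ∀ j : ℤ, label (f ^ (j + 1)) w = label (f ^ j) w + label f w := fun j => by
    rw [zpow_add_one, label_mul (zpow_mem_cyclicWreath hf j) hf, hw]
  induction i with
  | zero => simp [label_one]
  | succ i ih =>
    rw [key, ih]
    push_cast
    ring
  | pred i ih =>
    have h := key (-i - 1)
    rw [sub_add_cancel, ih] at h
    push_cast at h ⊢
    linear_combination -h

/-! ### Level sums -/

/-- The sum of the labels of `f` over the vertices of level `n`. -/
noncomputable def levelSum (f : Equiv.Perm (List (Fin k))) (n : ℕ) : ZMod k :=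
  ∑ w ∈ treeLevel k n, label f w

theorem levelSum_mul {f g : Equiv.Perm (List (Fin k))} (hf : f ∈ cyclicWreath k)
    (hg : g ∈ cyclicWreath k) (n : ℕ) : levelSum (f * g) n = levelSum f n + levelSum g n := by
  simp only [levelSum, label_mul hf hg, Finset.sum_add_distrib]
  congr 1
  refine Finset.sum_bij (fun w _ => g w) ?_ ?_ ?_ ?_
  · intro w hw
    simpa [length_apply hg] using hw
  · intro u _ v _ h
    exact g.injective h
  · intro w hw
    exact ⟨g⁻¹ w, mem_treeLevel.mpr ((length_apply (inv_mem hg) w).trans (mem_treeLevel.mp hw)),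
      by simp⟩
  · intros
    rfl

/-! ### Spherical transitivity -/

/-- The orbit of the leftmost vertex of level `n` under `f` has exactly `k ^ n` elements, that is,
it is the whole level; stated as a description of the stabilizer in the powers of `f`. -/
def FullOrbit (f : Equiv.Perm (List (Fin k))) (n : ℕ) : Prop :=
  ∀ i : ℤ, (f ^ i) (List.replicate n 0) = List.replicate n 0 ↔ (k : ℤ) ^ n ∣ i

theorem FullOrbit.zpow_apply_eq_iff {f : Equiv.Perm (List (Fin k))} {n : ℕ} (h : FullOrbit f n)
    (i j : ℤ) : (f ^ i) (List.replicate n 0) = (f ^ j) (List.replicate n 0) ↔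
      (k : ℤ) ^ n ∣ i - j := by
  rw [← h, sub_eq_neg_add, zpow_add, zpow_neg, Equiv.Perm.mul_apply, Equiv.Perm.inv_eq_iff_eq,
    eq_comm]

theorem FullOrbit.image_range {f : Equiv.Perm (List (Fin k))} (hf : f ∈ cyclicWreath k) {n : ℕ}
    (h : FullOrbit f n) : Set.InjOn (fun i : ℕ => (f ^ i) (List.replicate n 0))
      (Finset.range (k ^ n)) ∧
    (Finset.range (k ^ n)).image (fun i : ℕ => (f ^ i) (List.replicate n 0)) = treeLevel k n := by
  have hinj : Set.InjOn (fun i : ℕ => (f ^ i) (List.replicate n 0)) (Finset.range (k ^ n)) := by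
    intro i hi j hj hij
    have h1 := (h.zpow_apply_eq_iff i j).mp (by simpa using hij)
    simp only [Finset.coe_range, Set.mem_Iio] at hi hj
    have h2 : (j : ℤ) ≡ i [ZMOD ((k ^ n : ℕ) : ℤ)] := by
      rw [Int.modEq_iff_dvd]
      push_cast
      exact h1
    have h3 := (Int.natCast_modEq_iff.mp h2)
    exact (Nat.ModEq.eq_of_lt_of_lt h3 hj hi).symm
  refine ⟨hinj, Finset.eq_of_subset_of_card_le ?_ ?_⟩
  · intro w hw
    obtain ⟨i, -, rfl⟩ := Finset.mem_image.mp hw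
    simp [length_apply (Subgroup.pow_mem _ hf i)]
  · rw [Finset.card_image_of_injOn hinj, card_treeLevel, Finset.card_range]

theorem FullOrbit.exists_zpow {f : Equiv.Perm (List (Fin k))} (hf : f ∈ cyclicWreath k) {n : ℕ}
    (h : FullOrbit f n) {w : List (Fin k)} (hw : w.length = n) :
    ∃ i : ℤ, (f ^ i) (List.replicate n 0) = w := by
  rw [← mem_treeLevel, ← (h.image_range hf).2] at hw
  obtain ⟨i, -, hi⟩ := Finset.mem_image.mp hw
  exact ⟨i, by simpa using hi⟩

/-- The return map `f ^ (k ^ n)` to the leftmost vertex of level `n` collects the labels of `f` at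
all vertices of that level. -/
theorem FullOrbit.label_zpow_mul {f : Equiv.Perm (List (Fin k))} (hf : f ∈ cyclicWreath k) {n : ℕ}
    (h : FullOrbit f n) (j : ℤ) :
    label (f ^ ((k : ℤ) ^ n * j)) (List.replicate n 0) = j * levelSum f n := by
  rw [zpow_mul, label_zpow_of_fixed (zpow_mem_cyclicWreath hf _) ((h _).mpr dvd_rfl)]
  congr 1
  have h1 : f ^ ((k : ℤ) ^ n) = f ^ (k ^ n) := by
    rw [← zpow_natCast]
    push_cast
    rfl
  rw [h1, label_pow hf, levelSum, ← (h.image_range hf).2, Finset.sum_image (h.image_range hf).1]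

theorem FullOrbit.zpow_mul_apply {f : Equiv.Perm (List (Fin k))} (hf : f ∈ cyclicWreath k) {n : ℕ}
    (h : FullOrbit f n) (j : ℤ) : ∃ b : Fin k,
    (f ^ ((k : ℤ) ^ n * j)) (List.replicate (n + 1) 0) = List.replicate n 0 ++ [b] ∧
      (b.val : ZMod k) = j * levelSum f n := by
  obtain ⟨b, hb, hb'⟩ := apply_append_singleton (zpow_mem_cyclicWreath hf ((k : ℤ) ^ n * j))
    (List.replicate n 0) 0
  refine ⟨b, ?_, ?_⟩
  · rw [List.replicate_succ', hb, (h _).mpr (dvd_mul_right _ _)]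
  · rw [hb', h.label_zpow_mul hf]
    simp

theorem zpow_apply_replicate_take {f : Equiv.Perm (List (Fin k))} (hf : f ∈ cyclicWreath k)
    {m n : ℕ} (hmn : m ≤ n) (i : ℤ) :
    ((f ^ i) (List.replicate n 0)).take m = (f ^ i) (List.replicate m 0) := by
  rw [take_apply (zpow_mem_cyclicWreath hf i), List.take_replicate, min_eq_left hmn]

theorem fullOrbit_zero {f : Equiv.Perm (List (Fin k))} (hf : f ∈ cyclicWreath k) :
    FullOrbit f 0 := fun i => by
  simp [apply_nil (zpow_mem_cyclicWreath hf i)]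

theorem FullOrbit.succ {f : Equiv.Perm (List (Fin k))} (hf : f ∈ cyclicWreath k) {n : ℕ}
    (h : FullOrbit f n) (hu : IsUnit (levelSum f n)) : FullOrbit f (n + 1) := by
  -- Once `k ^ n` divides the exponent, the last letter decides.
  have key : ∀ j : ℤ, (f ^ ((k : ℤ) ^ n * j)) (List.replicate (n + 1) 0) =
      List.replicate (n + 1) 0 ↔ (k : ℤ) ∣ j := by
    intro j
    obtain ⟨b, hb, hb'⟩ := h.zpow_mul_apply hf j
    rw [hb, List.replicate_succ', List.append_cancel_left_eq, List.cons.injEq,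
      ← ZMod.intCast_zmod_eq_zero_iff_dvd, ← hu.mul_left_eq_zero, ← hb']
    constructor
    · rintro ⟨rfl, -⟩
      simp
    · intro h0
      exact ⟨fin_eq_of_cast_zmod_eq (by simpa using h0), rfl⟩
  intro i
  constructor
  · intro hi
    have h1 := zpow_apply_replicate_take hf n.le_succ i
    rw [hi, List.take_replicate, min_eq_left n.le_succ] at h1
    obtain ⟨j, rfl⟩ := (h i).mp h1.symm
    rw [pow_succ]
    exact mul_dvd_mul_left _ ((key j).mp hi)
  · rintro ⟨j, rfl⟩
    rw [pow_succ, mul_assoc]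
    exact (key _).mpr (dvd_mul_right _ _)

theorem FullOrbit.isUnit_levelSum {f : Equiv.Perm (List (Fin k))} (hf : f ∈ cyclicWreath k)
    {n : ℕ} (h : FullOrbit f n) (ht : SphericallyTransitive f) : IsUnit (levelSum f n) := by
  obtain ⟨a, ha⟩ := exists_fin_cast_eq (1 : ZMod k)
  obtain ⟨i, hi⟩ := ht (n + 1) (List.replicate (n + 1) 0) (List.replicate n 0 ++ [a])
    (by simp) (by simp)
  have h1 := zpow_apply_replicate_take hf n.le_succ i
  rw [hi, List.take_left' (by simp)] at h1
  obtain ⟨j, rfl⟩ := (h i).mp h1.symm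
  obtain ⟨b, hb, hb'⟩ := h.zpow_mul_apply hf j
  have hab : a = b := by simpa using hi.symm.trans hb
  rw [← hab, ha] at hb'
  exact IsUnit.of_mul_eq_one_right _ hb'.symm

theorem fullOrbit_of_isUnit_levelSum {f : Equiv.Perm (List (Fin k))} (hf : f ∈ cyclicWreath k)
    (hu : ∀ n, IsUnit (levelSum f n)) (n : ℕ) : FullOrbit f n := by
  induction n with
  | zero => exact fullOrbit_zero hf
  | succ n ih => exact ih.succ hf (hu n)

/-- `f` is spherically transitive if and only if each of its level sums generates `ℤ/kℤ`. -/
theorem sphericallyTransitive_iff {f : Equiv.Perm (List (Fin k))} (hf : f ∈ cyclicWreath k) :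
    SphericallyTransitive f ↔ ∀ n, IsUnit (levelSum f n) := by
  constructor
  · intro ht n
    have h : FullOrbit f n := by
      induction n with
      | zero => exact fullOrbit_zero hf
      | succ n ih => exact ih.succ hf (ih.isUnit_levelSum hf ht)
    exact h.isUnit_levelSum hf ht
  · intro hu n u v hun hvn
    have h := fullOrbit_of_isUnit_levelSum hf hu n
    obtain ⟨i, rfl⟩ := h.exists_zpow hf hun
    obtain ⟨j, rfl⟩ := h.exists_zpow hf hvn
    exact ⟨j - i, by rw [← Equiv.Perm.mul_apply, ← zpow_add, sub_add_cancel]⟩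

/-! ### Conjugacy of spherically transitive elements -/

theorem levelSum_eq_of_isConj {f g : cyclicWreath k} (h : IsConj f g) (n : ℕ) :
    levelSum (f : Equiv.Perm (List (Fin k))) n = levelSum (g : Equiv.Perm (List (Fin k))) n := by
  obtain ⟨c, hc⟩ := isConj_iff.mp h
  have h1 : (c : Equiv.Perm (List (Fin k))) * f = g * c := by
    rw [← hc]
    simp
  have h2 := levelSum_mul c.2 f.2 n
  rw [h1, levelSum_mul g.2 c.2, add_comm] at h2
  exact (add_left_cancel h2).symm

/-- If `f` and `g` have the same level sums and both act transitively on every level, then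
`f ^ i (0 ⋯ 0) ↦ g ^ i (0 ⋯ 0)` is a well-defined element of the wreath product, and it
conjugates `f` to `g`. -/
theorem isConj_of_levelSum_eq {f g : cyclicWreath k}
    (hf : ∀ n, IsUnit (levelSum (f : Equiv.Perm (List (Fin k))) n))
    (hfg : ∀ n, levelSum (f : Equiv.Perm (List (Fin k))) n =
      levelSum (g : Equiv.Perm (List (Fin k))) n) : IsConj f g := by
  obtain ⟨f, hfG⟩ := f
  obtain ⟨g, hgG⟩ := g
  simp only at hf hfg
  have Pf := fullOrbit_of_isUnit_levelSum hfG hf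
  have Pg := fullOrbit_of_isUnit_levelSum hgG fun n => hfg n ▸ hf n
  have ef : ∀ w : List (Fin k), ∃ i : ℤ, (f ^ i) (List.replicate w.length 0) = w :=
    fun w => (Pf _).exists_zpow hfG rfl
  have eg : ∀ w : List (Fin k), ∃ i : ℤ, (g ^ i) (List.replicate w.length 0) = w :=
    fun w => (Pg _).exists_zpow hgG rfl
  choose p hp using ef
  choose q hq using eg
  have lf : ∀ (i : ℤ) (n : ℕ), ((f ^ i) (List.replicate n 0)).length = n := fun i n => by
    simp [length_apply (zpow_mem_cyclicWreath hfG i)]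
  have lg : ∀ (i : ℤ) (n : ℕ), ((g ^ i) (List.replicate n 0)).length = n := fun i n => by
    simp [length_apply (zpow_mem_cyclicWreath hgG i)]
  have hfgiff : ∀ (i j : ℤ) (n : ℕ),
      (f ^ i) (List.replicate n 0) = (f ^ j) (List.replicate n 0) ↔
        (g ^ i) (List.replicate n 0) = (g ^ j) (List.replicate n 0) := fun i j n => by
    rw [(Pf n).zpow_apply_eq_iff, (Pg n).zpow_apply_eq_iff]
  -- The conjugator and its inverse, with their values on the orbits of the leftmost vertices.
  have hF : ∀ (i : ℤ) (n : ℕ),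
      (g ^ p ((f ^ i) (List.replicate n 0)))
        (List.replicate ((f ^ i) (List.replicate n 0)).length 0) =
          (g ^ i) (List.replicate n 0) := fun i n => by
    have h := hp ((f ^ i) (List.replicate n 0))
    rw [lf] at h ⊢
    exact (hfgiff _ _ n).mp h
  have hG : ∀ (i : ℤ) (n : ℕ),
      (f ^ q ((g ^ i) (List.replicate n 0)))
        (List.replicate ((g ^ i) (List.replicate n 0)).length 0) =
          (f ^ i) (List.replicate n 0) := fun i n => by
    have h := hq ((g ^ i) (List.replicate n 0))
    rw [lg] at h ⊢
    exact (hfgiff _ _ n).mpr h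
  let h : Equiv.Perm (List (Fin k)) :=
    { toFun := fun w => (g ^ p w) (List.replicate w.length 0)
      invFun := fun w => (f ^ q w) (List.replicate w.length 0)
      left_inv := fun w => by
        dsimp only
        rw [hG, hp]
      right_inv := fun w => by
        dsimp only
        rw [hF, hq] }
  have hh : ∀ (i : ℤ) (n : ℕ), h ((f ^ i) (List.replicate n 0)) = (g ^ i) (List.replicate n 0) :=
    hF
  have hcomm : h * f = g * h := by
    ext1 w
    obtain ⟨i, n, rfl⟩ : ∃ (i : ℤ) (n : ℕ), (f ^ i) (List.replicate n 0) = w := ⟨_, _, hp w⟩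
    rw [Equiv.Perm.mul_apply, Equiv.Perm.mul_apply, hh, ← Equiv.Perm.mul_apply f,
      ← Equiv.Perm.mul_apply g, ← zpow_one_add, ← zpow_one_add, hh]
  have hmem : h ∈ cyclicWreath k := by
    refine ⟨fun u v => ?_, fun w => ?_⟩
    · obtain ⟨i, m, rfl⟩ : ∃ (i : ℤ) (n : ℕ), (f ^ i) (List.replicate n 0) = u := ⟨_, _, hp u⟩
      obtain ⟨j, n, rfl⟩ : ∃ (i : ℤ) (n : ℕ), (f ^ i) (List.replicate n 0) = v := ⟨_, _, hp v⟩
      rw [hh, hh]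
      rcases le_or_gt m n with hmn | hmn
      · rw [List.prefix_iff_eq_take, List.prefix_iff_eq_take, lf, lg,
          zpow_apply_replicate_take hfG hmn, zpow_apply_replicate_take hgG hmn, hfgiff]
      · refine iff_of_false (fun H => ?_) fun H => ?_
        · have := H.length_le
          rw [lg, lg] at this
          omega
        · have := H.length_le
          rw [lf, lf] at this
          omega
    · obtain ⟨i, n, rfl⟩ : ∃ (i : ℤ) (n : ℕ), (f ^ i) (List.replicate n 0) = w := ⟨_, _, hp w⟩
      -- The children of `w` are the `f ^ (i + k ^ n * j) (0 ⋯ 0)`; as `j` varies, their last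
      -- letters, and those of their images, run through progressions with the same difference.
      have key : ∀ a : Fin k, ∃ b : Fin k,
          h ((f ^ i) (List.replicate n 0) ++ [a]) = h ((f ^ i) (List.replicate n 0)) ++ [b] ∧
          (b.val : ZMod k) = a.val + (label (g ^ i) (List.replicate n 0) -
            label (f ^ i) (List.replicate n 0)) := by
        intro a
        obtain ⟨u, hu⟩ := hf n
        obtain ⟨j, hj⟩ := ZMod.intCast_surjective
          (((a.val : ZMod k) - label (f ^ i) (List.replicate n 0)) * (↑u⁻¹ : ZMod k))
        have hj' : (j : ZMod k) * levelSum f n = a.val - label (f ^ i) (List.replicate n 0) := by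
          rw [hj, ← hu, mul_assoc, Units.inv_mul, mul_one]
        obtain ⟨b, hb, hb'⟩ := (Pf n).zpow_mul_apply hfG j
        obtain ⟨c, hc, hc'⟩ := (Pg n).zpow_mul_apply hgG j
        obtain ⟨d, hd, hd'⟩ := apply_append_singleton (zpow_mem_cyclicWreath hfG i)
          (List.replicate n 0) b
        obtain ⟨e, he, he'⟩ := apply_append_singleton (zpow_mem_cyclicWreath hgG i)
          (List.replicate n 0) c
        have hda : d = a := fin_eq_of_cast_zmod_eq (by rw [hd', hb', hj']; ring)
        refine ⟨e, ?_, ?_⟩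
        · rw [hh, ← he, ← hc, ← hda, ← hd, ← hb, ← Equiv.Perm.mul_apply (f ^ i),
            ← Equiv.Perm.mul_apply (g ^ i), ← zpow_add, ← zpow_add, hh]
        · rw [he', hc', ← hfg, hj']
          ring
      choose σ hσ hσ' using key
      have hinj : Function.Injective σ := fun a b hab => by
        apply fin_eq_of_cast_zmod_eq
        have h1 := hσ' a
        rw [hab, hσ' b] at h1
        exact (add_right_cancel h1).symm
      exact ⟨Equiv.ofBijective σ (Finite.injective_iff_bijective.mp hinj),
        mem_zpowers_finRotate_iff.mpr ⟨_, hσ'⟩, hσ⟩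
  exact isConj_iff.mpr ⟨⟨h, hmem⟩, Subtype.ext (mul_inv_eq_iff_eq_mul.mpr hcomm)⟩

/-- Within the wreath product, the level sums classify spherically transitive elements up to
conjugacy. -/
theorem isConj_iff_levelSum_eq {f g : cyclicWreath k}
    (h : SphericallyTransitive (f : Equiv.Perm (List (Fin k))) ∨
      SphericallyTransitive (g : Equiv.Perm (List (Fin k)))) :
    IsConj f g ↔ ∀ n, levelSum (f : Equiv.Perm (List (Fin k))) n =
      levelSum (g : Equiv.Perm (List (Fin k))) n := by
  refine ⟨fun hc n => levelSum_eq_of_isConj hc n, fun hfg => ?_⟩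
  rcases h with h | h
  · exact isConj_of_levelSum_eq ((sphericallyTransitive_iff f.2).mp h) hfg
  · exact isConj_of_levelSum_eq
      (fun n => (hfg n).symm ▸ (sphericallyTransitive_iff g.2).mp h n) hfg

end WreathProduct

/-! ### Level sums of an automaton -/

namespace InitialAutomaton

/-- The transfer operator of an automaton, on functions of the states: sum over the successors of a
state, one for each letter. -/
def transfer {n k : ℕ} (A : InitialAutomaton n k) {M : Type*} [AddCommMonoid M] (v : Fin n → M) :
    Fin n → M := fun q => ∑ a, v (A.next q a)

theorem transfer_iterate_natCast {n k : ℕ} (A : InitialAutomaton n k) (R : Type*) [Semiring R]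
    (v : Fin n → ℕ) (i : ℕ) (q : Fin n) :
    ((A.transfer^[i] v q : ℕ) : R) = A.transfer^[i] (fun q => (v q : R)) q := by
  induction i generalizing q with
  | zero => rfl
  | succ i ih =>
    rw [Function.iterate_succ_apply', Function.iterate_succ_apply', transfer, transfer,
      Nat.cast_sum]
    exact Finset.sum_congr rfl fun a _ => ih _

theorem run_append {n k : ℕ} (A : InitialAutomaton n k) (q : Fin n) (u w : List (Fin k)) :
    A.run q (u ++ w) = A.run q u ++ A.run (u.foldl A.next q) w := by
  induction u generalizing q with
  | nil => rfl
  | cons a u ih => simp [run, ih]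

/-- The sum of the labels over the part of a level below the vertex `u` only depends on the state
reached from the initial state by reading `u`. -/
theorem sum_label_append {n k : ℕ} [NeZero k] {A : InitialAutomaton n k}
    {f : Equiv.Perm (List (Fin k))} (hA : A.Computes f) (i : ℕ) (u : List (Fin k)) :
    ∑ w ∈ treeLevel k i, label f (u ++ w) =
      A.transfer^[i] (fun q => ((A.out q 0).val : ZMod k)) (u.foldl A.next A.init) := by
  induction i generalizing u with
  | zero =>
    rw [sum_treeLevel_zero, List.append_nil, label, ← hA, run_append]
    simp [run]
  | succ i ih =>
    rw [sum_treeLevel_succ, Function.iterate_succ_apply', transfer]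
    refine Finset.sum_congr rfl fun a _ => ?_
    have h := ih (u ++ [a])
    simpa using h

theorem levelSum_eq_transfer_iterate {n k : ℕ} [NeZero k] {A : InitialAutomaton n k}
    {f : Equiv.Perm (List (Fin k))} (hA : A.Computes f) (i : ℕ) :
    levelSum f i = A.transfer^[i] (fun q => ((A.out q 0).val : ZMod k)) A.init := by
  simpa [levelSum] using sum_label_append hA i []

end InitialAutomaton

/-- By the pigeonhole principle the first `card X` iterates already exhaust the orbit. -/
theorem exists_lt_card_iterate_eq {X : Type*} [Fintype X] (T : X → X) (x : X) (i : ℕ) :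
    ∃ j < Fintype.card X, T^[j] x = T^[i] x := by
  induction i using Nat.strong_induction_on with
  | _ i ih =>
    rcases lt_or_ge i (Fintype.card X) with hi | hi
    · exact ⟨i, hi, rfl⟩
    · obtain ⟨a, b, hab, h⟩ := Fintype.exists_ne_map_eq_of_card_lt
        (fun j : Fin (Fintype.card X + 1) => T^[j] x) (by simp)
      wlog hlt : a < b generalizing a b
      · exact this b a hab.symm h.symm (lt_of_le_of_ne (not_lt.mp hlt) hab.symm)
      have hb := b.2
      have hlt' : (a : ℕ) < b := hlt
      obtain ⟨j, hj, hj'⟩ := ih (i - b + a) (by omega)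
      refine ⟨j, hj, hj'.trans ?_⟩
      rw [Function.iterate_add_apply]
      rw [show T^[a] x = T^[b] x from h, ← Function.iterate_add_apply, Nat.sub_add_cancel (by omega)]

/-! ### Primitive recursive tests -/

/-- One step of the transfer operator of the automaton with table `T`, a function of the states
being given by the list of its values. -/
def transferList (T : List (List (ℕ × ℕ))) (v : List ℕ) : List ℕ :=
  T.map fun row => row.foldr (fun p s => v.getD p.1 0 + s) 0

/-- A representative in `ℕ` of the `i`-th level sum of the automaton with code `c`. -/
def codeLevelSum (c : ℕ × List (List (ℕ × ℕ))) (i : ℕ) : ℕ :=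
  ((transferList c.2)^[i] (c.2.map fun row => row.headI.2)).getD c.1 0

theorem transferList_code {n k : ℕ} (A : InitialAutomaton n k) (v : Fin n → ℕ) :
    transferList A.code.2 (List.ofFn v) = List.ofFn (A.transfer v) := by
  have hfold : ∀ l : List (ℕ × ℕ),
      l.foldr (fun p s => (List.ofFn v).getD p.1 0 + s) 0 =
        (l.map fun p => (List.ofFn v).getD p.1 0).sum := fun l => by
    induction l with
    | nil => rfl
    | cons p l ih => rw [List.foldr_cons, ih, List.map_cons, List.sum_cons]
  simp only [transferList, InitialAutomaton.code, hfold, List.map_ofFn]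
  congr 1
  funext q
  simp [List.sum_ofFn, List.map_ofFn, InitialAutomaton.transfer, Function.comp_def]

theorem codeLevelSum_code {n k : ℕ} [NeZero k] (A : InitialAutomaton n k) (i : ℕ) :
    codeLevelSum A.code i = A.transfer^[i] (fun q => (A.out q 0).val) A.init := by
  have h0 : (A.code.2.map fun row => row.headI.2) = List.ofFn fun q => (A.out q 0).val := by
    obtain ⟨k, rfl⟩ := Nat.exists_eq_succ_of_ne_zero (NeZero.ne k)
    simp [InitialAutomaton.code, List.map_ofFn, Function.comp_def, List.ofFn_succ]
  have hi : (transferList A.code.2)^[i] (List.ofFn fun q => (A.out q 0).val) =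
      List.ofFn (A.transfer^[i] fun q => (A.out q 0).val) := by
    induction i with
    | zero => rfl
    | succ i ih =>
      rw [Function.iterate_succ_apply', Function.iterate_succ_apply', ih, transferList_code]
  rw [codeLevelSum, h0, hi]
  simp [InitialAutomaton.code]

theorem natCast_codeLevelSum {n k : ℕ} [NeZero k] {A : InitialAutomaton n k}
    {f : Equiv.Perm (List (Fin k))} (hA : A.Computes f) (i : ℕ) :
    (codeLevelSum A.code i : ZMod k) = levelSum f i := by
  rw [codeLevelSum_code, A.transfer_iterate_natCast, A.levelSum_eq_transfer_iterate hA]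

theorem length_code {n k : ℕ} (A : InitialAutomaton n k) : A.code.2.length = n := by
  simp [InitialAutomaton.code]

theorem primrec_codeLevelSum : Primrec₂ codeLevelSum := by
  have hinit : Primrec fun T : List (List (ℕ × ℕ)) => T.map fun row => row.headI.2 :=
    Primrec.list_map .id (Primrec.snd.comp (Primrec.list_headI.comp .snd)).to₂
  have hstep : Primrec₂ transferList := by
    refine Primrec.list_map .fst ?_
    refine Primrec.list_foldr (f := fun x : (List (List (ℕ × ℕ)) × List ℕ) × List (ℕ × ℕ) => x.2)
      (g := fun _ => 0) (h := fun x y => x.1.2.getD y.1.1 0 + y.2) .snd (.const 0) ?_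
    exact (Primrec.nat_add.comp
      ((Primrec.list_getD 0).comp (Primrec.snd.comp (Primrec.fst.comp .fst))
        (Primrec.fst.comp (Primrec.fst.comp .snd)))
      (Primrec.snd.comp .snd)).to₂
  refine (Primrec.list_getD 0).comp ?_ (Primrec.fst.comp .fst)
  refine Primrec.nat_iterate .snd (hinit.comp (Primrec.snd.comp .fst)) ?_
  exact hstep.comp (Primrec.snd.comp (Primrec.fst.comp .fst)) .snd

theorem primrec_nat_pow : Primrec₂ ((· ^ ·) : ℕ → ℕ → ℕ) :=
  Primrec₂.unpaired'.1 Nat.Primrec.pow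

/-- The level sums with index below `k ^ n`, for `n` states, are units modulo `k`; invertibility is
expressed through a residue that is an inverse. -/
def UnitLevelSums (x : ℕ × (ℕ × List (List (ℕ × ℕ)))) : Prop :=
  ∀ i ∈ List.range (x.1 ^ x.2.2.length), ∃ y ∈ List.range x.1,
    y * codeLevelSum x.2 i % x.1 = 1 % x.1

/-- The level sums of two automata with index below `k ^ (m + n)`, for `m` and `n` states, agree
modulo `k`. -/
def EqualLevelSums (x : ℕ × (ℕ × List (List (ℕ × ℕ))) × (ℕ × List (List (ℕ × ℕ)))) : Prop :=
  ∀ i ∈ List.range (x.1 ^ (x.2.1.2.length + x.2.2.2.length)),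
    codeLevelSum x.2.1 i % x.1 = codeLevelSum x.2.2 i % x.1

theorem primrecPred_unitLevelSums : PrimrecPred UnitLevelSums := by
  have h1 : PrimrecRel fun (y : ℕ) (p : ℕ × ℕ × (ℕ × List (List (ℕ × ℕ)))) =>
      y * codeLevelSum p.2.2 p.1 % p.2.1 = 1 % p.2.1 :=
    Primrec.eq.comp
      (Primrec.nat_mod.comp
        (Primrec.nat_mul.comp .fst (primrec_codeLevelSum.comp
          (Primrec.snd.comp (Primrec.snd.comp .snd)) (Primrec.fst.comp .snd)))
        (Primrec.fst.comp (Primrec.snd.comp .snd)))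
      (Primrec.nat_mod.comp (.const 1) (Primrec.fst.comp (Primrec.snd.comp .snd)))
  have h2 : PrimrecRel fun (i : ℕ) (x : ℕ × (ℕ × List (List (ℕ × ℕ)))) =>
      ∃ y ∈ List.range x.1, y * codeLevelSum x.2 i % x.1 = 1 % x.1 :=
    h1.exists_mem_list.comp (Primrec.list_range.comp (Primrec.fst.comp .snd)) .id
  exact h2.forall_mem_list.comp (Primrec.list_range.comp (primrec_nat_pow.comp .fst
    (Primrec.list_length.comp (Primrec.snd.comp .snd)))) .id

theorem primrecPred_equalLevelSums : PrimrecPred EqualLevelSums := by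
  have h : PrimrecRel fun (i : ℕ)
      (x : ℕ × (ℕ × List (List (ℕ × ℕ))) × (ℕ × List (List (ℕ × ℕ)))) =>
      codeLevelSum x.2.1 i % x.1 = codeLevelSum x.2.2 i % x.1 :=
    Primrec.eq.comp
      (Primrec.nat_mod.comp (primrec_codeLevelSum.comp
        (Primrec.fst.comp (Primrec.snd.comp .snd)) .fst) (Primrec.fst.comp .snd))
      (Primrec.nat_mod.comp (primrec_codeLevelSum.comp
        (Primrec.snd.comp (Primrec.snd.comp .snd)) .fst) (Primrec.fst.comp .snd))
  exact h.forall_mem_list.comp (Primrec.list_range.comp (primrec_nat_pow.comp .fst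
    (Primrec.nat_add.comp
      (Primrec.list_length.comp (Primrec.snd.comp (Primrec.fst.comp .snd)))
      (Primrec.list_length.comp (Primrec.snd.comp (Primrec.snd.comp .snd)))))) .id

theorem unitLevelSums_iff {n k : ℕ} [NeZero k] {A : InitialAutomaton n k}
    {f : Equiv.Perm (List (Fin k))} (hA : A.Computes f) :
    UnitLevelSums (k, A.code) ↔ ∀ i, IsUnit (levelSum f i) := by
  have key : ∀ i, (∃ y ∈ List.range k, y * codeLevelSum A.code i % k = 1 % k) ↔
      IsUnit (levelSum f i) := by
    intro i
    constructor
    · rintro ⟨y, -, hy⟩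
      rw [← ZMod.natCast_eq_natCast_iff', Nat.cast_mul, natCast_codeLevelSum hA,
        Nat.cast_one] at hy
      exact IsUnit.of_mul_eq_one_right _ hy
    · rintro ⟨u, hu⟩
      refine ⟨(↑u⁻¹ : ZMod k).val, List.mem_range.mpr (ZMod.val_lt _), ?_⟩
      rw [← ZMod.natCast_eq_natCast_iff', Nat.cast_mul, natCast_codeLevelSum hA, ← hu,
        ZMod.natCast_zmod_val, Units.inv_mul, Nat.cast_one]
  simp only [UnitLevelSums, key]
  simp only [length_code, List.mem_range]
  refine ⟨fun h i => ?_, fun h i _ => h i⟩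
  obtain ⟨j, hj, hji⟩ := exists_lt_card_iterate_eq (A.transfer (M := ZMod k))
    (fun q => ((A.out q 0).val : ZMod k)) i
  rw [A.levelSum_eq_transfer_iterate hA, ← hji, ← A.levelSum_eq_transfer_iterate hA]
  exact h j (by simpa [ZMod.card] using hj)

theorem equalLevelSums_iff {m n k : ℕ} [NeZero k] {A : InitialAutomaton m k}
    {B : InitialAutomaton n k} {f g : Equiv.Perm (List (Fin k))} (hA : A.Computes f)
    (hB : B.Computes g) :
    EqualLevelSums (k, A.code, B.code) ↔ ∀ i, levelSum f i = levelSum g i := by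
  simp only [EqualLevelSums, length_code, List.mem_range, ← ZMod.natCast_eq_natCast_iff',
    natCast_codeLevelSum hA, natCast_codeLevelSum hB]
  refine ⟨fun h i => ?_, fun h i _ => h i⟩
  -- The pairs of functions of the states are iterated jointly.
  obtain ⟨j, hj, hji⟩ := exists_lt_card_iterate_eq
    (Prod.map (A.transfer (M := ZMod k)) (B.transfer (M := ZMod k)))
    (fun q => ((A.out q 0).val : ZMod k), fun q => ((B.out q 0).val : ZMod k)) i
  simp only [Prod.map_iterate, Prod.map_apply, Prod.mk.injEq] at hji
  rw [A.levelSum_eq_transfer_iterate hA, B.levelSum_eq_transfer_iterate hB, ← hji.1, ← hji.2,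
    ← A.levelSum_eq_transfer_iterate hA, ← B.levelSum_eq_transfer_iterate hB]
  exact h j (by simpa [ZMod.card, pow_add] using hj)

theorem theorem1p3 :
    ∃ (transTest : ℕ × (ℕ × List (List (ℕ × ℕ))) → Bool)
      (conjTest : ℕ × (ℕ × List (List (ℕ × ℕ))) × (ℕ × List (List (ℕ × ℕ))) → Bool),
      Computable transTest ∧ Computable conjTest ∧
      (∀ (k : ℕ), 0 < k → ∀ (n : ℕ) (A : InitialAutomaton n k) (f : cyclicWreath k),
        A.Computes f →
          (transTest (k, A.code) = true ↔ SphericallyTransitive (f : Equiv.Perm (List (Fin k))))) ∧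
      (∀ (k : ℕ), 0 < k → ∀ (m n : ℕ) (A : InitialAutomaton m k) (B : InitialAutomaton n k)
        (f g : cyclicWreath k), A.Computes f → B.Computes g →
          (SphericallyTransitive (f : Equiv.Perm (List (Fin k))) ∨
            SphericallyTransitive (g : Equiv.Perm (List (Fin k)))) →
          (conjTest (k, A.code, B.code) = true ↔ IsConj f g)) := by
  obtain ⟨hd, ht⟩ := primrecPred_unitLevelSums
  obtain ⟨hd', hc⟩ := primrecPred_equalLevelSums
  refine ⟨_, _, ht.to_comp, hc.to_comp, ?_, ?_⟩
  · intro k hk n A f hA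
    have : NeZero k := ⟨hk.ne'⟩
    rw [decide_eq_true_iff, unitLevelSums_iff hA, sphericallyTransitive_iff f.2]
  · intro k hk m n A B f g hA hB h
    have : NeZero k := ⟨hk.ne'⟩
    rw [decide_eq_true_iff, equalLevelSums_iff hA hB, isConj_iff_levelSum_eq h]
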